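/- Throughout, $R$ is a commutative ring with identity and $C$ is a semidualizing $R$-module, i.e. $C$ has a projective resolution by finitely generated projective modules, the homothety map $R\to \mathrm{Hom}_R(C,C)$ is an isomorphism, and $\mathrm{Ext}_R^{n}(C,C)=0$ for all $n\ge 1$. A module is called $C$-projective (resp. $C$-flat) if it is isomorphic to $C\otimes_R P$ with $P$ projective (resp. to $C\otimes_R F$ with $F$ flat). Complexes $X=\cdots\to X^{n+1}\to X^{n}\to X^{n-1}\to\cdots$ of $R$-modules are indexed by $\mathbb Z$, and $\mathrm{Ch}(R)$ is the abelian category of such complexes. A complex is called projective (resp. $C$-projective, $C$-flat) if it is exact and all its cycle modules are projective (resp. $C$-projective, $C$-flat). An $R$-module $M$ is called $D_C$-projective if there is an exact sequence of $R$-modules $$\cdots\to T_1\to T_0\xrightarrow{\ \partial_0\ } T_{-1}\to T_{-2}\to\cdots$$ with $T_i$ projective for $i\ge 0$, $T_i$ $C$-projective for $i<0$ and $M\cong \mathrm{Im}\,\partial_0$, which stays exact after applying $\mathrm{Hom}_R(-,F)$ for every $C$-flat module $F$. A complex $X$ of $R$-modules is called $D_C$-projective if there is an exact sequence in $\mathrm{Ch}(R)$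 $$\cdots\to P_1\to P_0\xrightarrow{\ f_0\ } Q_{-1}\to Q_{-2}\to\cdots$$ with every $P_i$ a projective complex, every $Q_i$ a $C$-projective complex and $X\cong \mathrm{Im}\,f_0$, which stays exact after applying $\mathrm{Hom}_{\mathrm{Ch}(R)}(-,H)$ for every $C$-flat complex $H$. **Corollary 2.12.** Let $0\to X\to Y\to Z\to 0$ be a short exact sequence in $\mathrm{Ch}(R)$ with $X$ and $Y$ $D_C$-projective complexes. Then the following are equivalent: 1. $Z$ is a $D_C$-projective complex; 2. $Z^i$ is a $D_C$-projective $R$-module for every $i\in\mathbb Z$; 3. $\mathrm{Ext}^1_{\mathrm{Ch}(R)}(Z,H)=0$ for every $C$-flat complex $H$. -/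

import Mathlib

open CategoryTheory CategoryTheory.Limits

universe v u

namespace DingC

section Abelian

variable {A : Type u} [Category.{v} A] [Abelian A]

/-- `Hom(T, B)` is exact, i.e. for every `n` the sequence of abelian groups
`Hom(Tₙ₋₁, B) ⟶ Hom(Tₙ, B) ⟶ Hom(Tₙ₊₁, B)` is exact at the middle term. -/
def HomExact (T : ChainComplex A ℤ) (B : A) : Prop :=
  ∀ n : ℤ, Function.Exact
    (fun g : T.X (n - 1) ⟶ B => T.d n (n - 1) ≫ g)
    (fun g : T.X n ⟶ B => T.d (n + 1) n ≫ g)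

/-- There is a `Hom(-, F)`-exact exact sequence
`⋯ ⟶ T₁ ⟶ T₀ ⟶ T₋₁ ⟶ T₋₂ ⟶ ⋯` in the abelian category `A` with `Tᵢ ∈ P` for `i ≥ 0` and
`Tᵢ ∈ Q` for `i < 0` such that `M ≅ Im (T₀ ⟶ T₋₁)`. -/
def HasCompleteResolution (P Q F : ObjectProperty A) (M : A) : Prop :=
  ∃ T : ChainComplex A ℤ,
    T.Acyclic ∧
    (∀ B : A, F B → HomExact T B) ∧
    (∀ i : ℤ, 0 ≤ i → P (T.X i)) ∧
    (∀ i : ℤ, i < 0 → Q (T.X i)) ∧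
    Nonempty (M ≅ image (T.d 0 (-1)))

/-- The class of `𝒳`-complexes: exact complexes all of whose cycles `Zᵢ(X)` lie in `𝒳`. -/
def tildeClass (𝒳 : ObjectProperty A) : ObjectProperty (ChainComplex A ℤ) :=
  fun X => X.Acyclic ∧ ∀ i : ℤ, 𝒳 (X.cycles i)

end Abelian

variable {R : Type u} [CommRing R]

/-- Semidualizing modules over a commutative ring. -/
structure IsSemidualizing (C : ModuleCat.{u} R) : Prop where
  /-- `C` has a projective resolution by finitely generated modules. -/
  exists_resolution : ∃ P : ProjectiveResolution C, ∀ n : ℕ, Module.Finite R (P.complex.X n)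
  /-- The homothety map `R ⟶ Hom_R(C, C)`, `r ↦ (c ↦ r • c)`, is an isomorphism. -/
  homothety_bijective : Function.Bijective (LinearMap.lsmul R C)
  /-- `Ext^n(C, C) = 0` for all `n ≥ 1`. -/
  ext_eq_zero : ∀ n : ℕ, 1 ≤ n → Subsingleton (Abelian.Ext.{u} C C n)

/-- The class `𝒫(R)` of projective modules. -/
def projectiveModules (R : Type u) [CommRing R] : ObjectProperty (ModuleCat.{u} R) :=
  fun M => Module.Projective R M

/-- The class `𝒫_C(R)` of `C`-projective modules: the modules `C ⊗ P` with `P` projective,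
up to isomorphism. -/
def cProjectiveModules (C : ModuleCat.{u} R) : ObjectProperty (ModuleCat.{u} R) :=
  fun M => ∃ P : ModuleCat.{u} R, Module.Projective R P ∧
    Nonempty (M ≃ₗ[R] TensorProduct R C P)

/-- The class `ℱ_C(R)` of `C`-flat modules: the modules `C ⊗ F` with `F` flat,
up to isomorphism. -/
def cFlatModules (C : ModuleCat.{u} R) : ObjectProperty (ModuleCat.{u} R) :=
  fun M => ∃ F : ModuleCat.{u} R, Module.Flat R F ∧
    Nonempty (M ≃ₗ[R] TensorProduct R C F)

/-- Projective complexes: exact complexes with projective cycles. -/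
def projectiveComplexes (R : Type u) [CommRing R] :
    ObjectProperty (ChainComplex (ModuleCat.{u} R) ℤ) :=
  tildeClass (projectiveModules R)

/-- `C`-projective complexes: exact complexes with `C`-projective cycles. -/
def cProjectiveComplexes (C : ModuleCat.{u} R) :
    ObjectProperty (ChainComplex (ModuleCat.{u} R) ℤ) :=
  tildeClass (cProjectiveModules C)

/-- `C`-flat complexes: exact complexes with `C`-flat cycles. -/
def cFlatComplexes (C : ModuleCat.{u} R) :
    ObjectProperty (ChainComplex (ModuleCat.{u} R) ℤ) :=
  tildeClass (cFlatModules C)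

/-- `D_C`-projective modules. -/
def IsDCProjectiveModule (C M : ModuleCat.{u} R) : Prop :=
  HasCompleteResolution (projectiveModules R) (cProjectiveModules C) (cFlatModules C) M

/-- `D_C`-projective complexes; here the complete resolution is a sequence of complexes. -/
def IsDCProjectiveComplex (C : ModuleCat.{u} R) (X : ChainComplex (ModuleCat.{u} R) ℤ) : Prop :=
  HasCompleteResolution (projectiveComplexes R) (cProjectiveComplexes C) (cFlatComplexes C) X

end DingC

universe w

/-!
Both for modules and for complexes, `D_C`-projectivity only concerns the right half of a complete
resolution: as `C`-projectives have no higher extensions by `C`-flats, `M` is `D_C`-projective if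
and only if it has a coresolution by `C`-projectives whose cosyzygies are left orthogonal to the
`C`-flats. Objects with such a coresolution are closed under extensions, under kernels of
epimorphisms and, by a pushout, under those cokernels of monomorphisms on which `Ext¹(-, F)`
vanishes for all `C`-flats `F`.

A projective or `C`-projective complex is a retract of a contractible one, and morphisms into a
contractible complex are just families of morphisms of the terms. So complete resolutions of
complexes restrict to their terms. Moreover every complex `H` is a quotient of a contractible
complex by a shift of `H`: if `Ext¹(X, -)` vanishes on that shift, a morphism `X ⟶ H` lifts to the
contractible complex, where it can be extended to `Y` degreewise, and then be projected to `H`.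
-/

namespace DingC

section Syzygy

variable {A : Type u} [Category.{v} A] [Abelian A] [EnoughProjectives A] (N : A)

/-- The sequence `0 ⟶ K ⟶ T ⟶ N ⟶ 0` with `T` the chosen projective object over `N`, and so `K`
a syzygy of `N`. -/
noncomputable abbrev syzygyShortComplex : ShortComplex A :=
  .mk (kernel.ι (Projective.π N)) (Projective.π N) (kernel.condition _)

lemma shortExact_syzygyShortComplex : (syzygyShortComplex N).ShortExact where
  exact := ShortComplex.exact_of_f_is_kernel _ (kernelIsKernel _)

end Syzygy

section Ext

variable {A : Type u} [Category.{v} A] [Abelian A] [HasExt.{w} A]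

open Abelian

/-- `M` is left orthogonal to `B`: all the groups `Extⁿ(M, B)` with `n ≥ 1` vanish. -/
def ExtOrthogonal (M B : A) : Prop :=
  ∀ n : ℕ, Subsingleton (Ext M B (n + 1))

variable {S : ShortComplex A} {M N B : A}

lemma exists_extension_of_ext_one (hS : S.ShortExact) (h : Subsingleton (Ext S.X₃ B 1))
    (φ : S.X₁ ⟶ B) : ∃ ψ : S.X₂ ⟶ B, S.f ≫ ψ = φ := by
  obtain ⟨x, hx⟩ := Ext.contravariant_sequence_exact₁ hS B (Ext.mk₀ φ) (n₁ := 1) rfl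
    (Subsingleton.elim _ _)
  obtain ⟨ψ, rfl⟩ := (Ext.mk₀_bijective _ _).2 x
  exact ⟨ψ, (Ext.mk₀_bijective _ _).1 ((Ext.mk₀_comp_mk₀ _ _).symm.trans hx)⟩

lemma exists_lift_of_ext_one (hS : S.ShortExact) (h : Subsingleton (Ext M S.X₁ 1))
    (φ : M ⟶ S.X₃) : ∃ ψ : M ⟶ S.X₂, ψ ≫ S.g = φ := by
  obtain ⟨x, hx⟩ := Ext.covariant_sequence_exact₃ M hS (Ext.mk₀ φ) (n₁ := 1) rfl
    (Subsingleton.elim _ _)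
  obtain ⟨ψ, rfl⟩ := (Ext.mk₀_bijective _ _).2 x
  exact ⟨ψ, (Ext.mk₀_bijective _ _).1 ((Ext.mk₀_comp_mk₀ _ _).symm.trans hx)⟩

lemma ext_one_of_exists_extension (hS : S.ShortExact) (h : Subsingleton (Ext S.X₂ B 1))
    (hB : ∀ φ : S.X₁ ⟶ B, ∃ ψ : S.X₂ ⟶ B, S.f ≫ ψ = φ) : Subsingleton (Ext S.X₃ B 1) := by
  refine subsingleton_of_forall_eq 0 fun x => ?_
  obtain ⟨y, rfl⟩ := Ext.contravariant_sequence_exact₃ hS B x (Subsingleton.elim _ _)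
    (n₀ := 0) rfl
  obtain ⟨φ, rfl⟩ := (Ext.mk₀_bijective _ _).2 y
  obtain ⟨ψ, rfl⟩ := hB φ
  rw [← Ext.mk₀_comp_mk₀, hS.extClass_comp_assoc]

lemma subsingleton_ext_of_retract (r : Retract M N) {n : ℕ} (h : Subsingleton (Ext N B n)) :
    Subsingleton (Ext M B n) := by
  refine subsingleton_of_forall_eq 0 fun x => ?_
  rw [← Ext.mk₀_id_comp x, ← r.retract, ← Ext.mk₀_comp_mk₀, Ext.comp_assoc_of_second_deg_zero,
    Subsingleton.elim ((Ext.mk₀ r.r).comp x _) 0, Ext.comp_zero]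

namespace ExtOrthogonal

lemma exists_extension (hS : S.ShortExact) (h : ExtOrthogonal S.X₃ B) (φ : S.X₁ ⟶ B) :
    ∃ ψ : S.X₂ ⟶ B, S.f ≫ ψ = φ :=
  exists_extension_of_ext_one hS (h 0) φ

lemma of_projective (M B : A) [Projective M] : ExtOrthogonal M B :=
  fun n => Ext.subsingleton_of_projective M B n

lemma of_retract (r : Retract M N) (h : ExtOrthogonal N B) : ExtOrthogonal M B :=
  fun n => subsingleton_ext_of_retract r (h n)

lemma of_iso (e : M ≅ N) (h : ExtOrthogonal N B) : ExtOrthogonal M B :=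
  h.of_retract (Retract.ofIso e)

lemma X₁ (hS : S.ShortExact) (h₂ : ExtOrthogonal S.X₂ B) (h₃ : ExtOrthogonal S.X₃ B) :
    ExtOrthogonal S.X₁ B := by
  refine fun n => subsingleton_of_forall_eq 0 fun x => ?_
  have := h₂ n
  obtain ⟨y, rfl⟩ := Ext.contravariant_sequence_exact₁ hS B x (add_comm _ _)
    ((h₃ (n + 1)).elim _ _)
  rw [Subsingleton.elim y 0, Ext.comp_zero]

lemma X₂ (hS : S.ShortExact) (h₁ : ExtOrthogonal S.X₁ B) (h₃ : ExtOrthogonal S.X₃ B) :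
    ExtOrthogonal S.X₂ B := by
  refine fun n => subsingleton_of_forall_eq 0 fun x => ?_
  have := h₃ n
  obtain ⟨y, rfl⟩ := Ext.contravariant_sequence_exact₂ hS B x ((h₁ n).elim _ _)
  rw [Subsingleton.elim y 0, Ext.comp_zero]

lemma right_X₂ (hS : S.ShortExact) (h₁ : ExtOrthogonal M S.X₁) (h₃ : ExtOrthogonal M S.X₃) :
    ExtOrthogonal M S.X₂ := by
  refine fun n => subsingleton_of_forall_eq 0 fun x => ?_
  have := h₁ n
  obtain ⟨y, rfl⟩ := Ext.covariant_sequence_exact₂ M hS x ((h₃ n).elim _ _)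
  rw [Subsingleton.elim y 0, Ext.zero_comp]

lemma of_iso_right {B' : A} (h : ExtOrthogonal M B) (e : B' ≅ B) : ExtOrthogonal M B' := by
  refine fun n => subsingleton_of_forall_eq 0 fun x => ?_
  have := h n
  rw [← Ext.comp_mk₀_id x, ← e.hom_inv_id, ← Ext.mk₀_comp_mk₀,
    ← Ext.comp_assoc_of_third_deg_zero, Subsingleton.elim (x.comp (Ext.mk₀ e.hom) _) 0,
    Ext.zero_comp]

/-- Dimension shifting: the family `S` is closed under the syzygies it exhibits. -/
lemma of_family {ι : Type*} {S : ι → ShortComplex A} (hS : ∀ i, (S i).ShortExact)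
    (hsyz : ∀ i, ∃ j, Nonempty ((S i).X₁ ≅ (S j).X₃)) (h₂ : ∀ i, ExtOrthogonal (S i).X₂ B)
    (hB : ∀ i (φ : (S i).X₁ ⟶ B), ∃ ψ : (S i).X₂ ⟶ B, (S i).f ≫ ψ = φ) (i : ι) :
    ExtOrthogonal (S i).X₃ B := by
  intro n
  induction n generalizing i with
  | zero => exact ext_one_of_exists_extension (hS i) (h₂ i 0) (hB i)
  | succ n ih =>
    obtain ⟨j, ⟨e⟩⟩ := hsyz i
    refine subsingleton_of_forall_eq 0 fun x => ?_
    obtain ⟨y, rfl⟩ := Ext.contravariant_sequence_exact₃ (hS i) B x ((h₂ i (n + 1)).elim _ _)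
      (add_comm 1 (n + 1))
    have := subsingleton_ext_of_retract (Retract.ofIso e) (ih j)
    rw [Subsingleton.elim y 0, Ext.comp_zero]

end ExtOrthogonal

end Ext

section Complexes

variable {A : Type u} [Category.{v} A] [Abelian A] {ι : Type*} {c : ComplexShape ι}

/-- The sequence `opcycles j ⟶ X i ⟶ opcycles i` of a complex, for `j` and `i` consecutive. It is
short exact where the complex is exact, so that `opcycles j` is then a syzygy of `opcycles i`. -/
noncomputable abbrev opcyclesShortComplex (T : HomologicalComplex A c) (j i : ι) :
    ShortComplex A :=
  .mk (T.fromOpcycles j i) (T.pOpcycles i) (by rw [← cancel_epi (T.pOpcycles j)]; simp)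

lemma shortExact_opcyclesShortComplex (T : HomologicalComplex A c) {j i : ι} (hij : c.Rel j i)
    (hT : T.ExactAt j) : (opcyclesShortComplex T j i).ShortExact where
  exact := ShortComplex.exact_of_g_is_cokernel _ <|
    isCokernelOfComp _ _ (T.opcyclesIsCokernel j i (c.prev_eq' hij)) _ (T.p_fromOpcycles j i)
  mono_f := by
    obtain rfl := c.next_eq' hij
    exact (T.sc j).exact_iff_mono_fromOpcycles.1 hT
  epi_g := inferInstanceAs (Epi (T.pOpcycles i))

/-- The sequence `cycles j ⟶ X j ⟶ cycles i` of a complex, for `j` and `i` consecutive. It is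
short exact where the complex is exact. -/
noncomputable abbrev cyclesShortComplex (T : HomologicalComplex A c) (j i : ι) :
    ShortComplex A :=
  .mk (T.iCycles j) (T.toCycles j i) (by rw [← cancel_mono (T.iCycles i)]; simp)

lemma shortExact_cyclesShortComplex (T : HomologicalComplex A c) {j i : ι} (hij : c.Rel j i)
    (hT : T.ExactAt i) : (cyclesShortComplex T j i).ShortExact where
  exact := ShortComplex.exact_of_f_is_kernel _ <|
    isKernelOfComp _ _ (T.cyclesIsKernel j i (c.next_eq' hij)) _ (T.toCycles_i j i)
  mono_f := inferInstanceAs (Mono (T.iCycles j))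
  epi_g := by
    obtain rfl := c.prev_eq' hij
    exact (T.sc i).exact_iff_epi_toCycles.1 hT

lemma exact_comp_d_iff (T : HomologicalComplex A c) {k j i : ι} (hjk : c.Rel k j) (B : A) :
    Function.Exact (fun ψ : T.X i ⟶ B => T.d j i ≫ ψ) (fun ψ : T.X j ⟶ B => T.d k j ≫ ψ) ↔
      ∀ φ : T.opcycles j ⟶ B, ∃ ψ : T.X i ⟶ B, T.fromOpcycles j i ≫ ψ = φ := by
  constructor
  · intro h φ
    obtain ⟨ψ, hψ⟩ := (h (T.pOpcycles j ≫ φ)).1 (by simp)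
    exact ⟨ψ, by rw [← cancel_epi (T.pOpcycles j), ← hψ, T.p_fromOpcycles_assoc]⟩
  · refine fun h φ => ⟨fun hφ => ?_, ?_⟩
    · obtain ⟨ψ, hψ⟩ := h (T.descOpcycles φ k (c.prev_eq' hjk) hφ)
      exact ⟨ψ, by simp only [← T.p_fromOpcycles, Category.assoc, hψ, T.p_descOpcycles]⟩
    · rintro ⟨ψ, rfl⟩
      simp

lemma homExact_iff (T : ChainComplex A ℤ) (B : A) :
    HomExact T B ↔ ∀ i j : ℤ, i + 1 = j → ∀ φ : T.opcycles j ⟶ B,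
      ∃ ψ : T.X i ⟶ B, T.fromOpcycles j i ≫ ψ = φ := by
  constructor
  · intro h i j hij
    obtain rfl : i = j - 1 := by lia
    exact (exact_comp_d_iff T (by simp) B).1 (h j)
  · exact fun h n => (exact_comp_d_iff T (by simp) B).2 (h (n - 1) n (by lia))

/-- In an exact complex the image of a differential is its coimage, the object of opcycles. -/
noncomputable def imageIsoOpcycles (T : ChainComplex A ℤ) (hT : T.Acyclic) {i j : ℤ}
    (hij : i + 1 = j) : image (T.d j i) ≅ T.opcycles j :=
  have := (shortExact_opcyclesShortComplex T (i := i) (by simpa) (hT j)).mono_f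
  have := strongEpi_of_epi (T.pOpcycles j)
  (image.isoStrongEpiMono (T.pOpcycles j) (T.fromOpcycles j i) (T.p_fromOpcycles j i)).symm

end Complexes

section Splice

variable {A : Type u} [Category.{v} A] [Abelian A] {T : ChainComplex A ℤ} {O : ℤ → A}
  {f : ∀ n, O (n + 1) ⟶ T.X n} {g : ∀ n, T.X n ⟶ O n} {w : ∀ n, f n ≫ g n = 0}
  (hS : ∀ n, (ShortComplex.mk (f n) (g n) (w n)).ShortExact)
  (hd : ∀ n, T.d (n + 1) n = g (n + 1) ≫ f n)

include hS hd

/-- If `T` is spliced from the short exact sequences `O (n + 1) ⟶ T n ⟶ O n`, then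
`g n : T n ⟶ O n` is a cokernel of the differential. -/
noncomputable def spliceIsColimit (n : ℤ) :
    IsColimit (CokernelCofork.ofπ (f := T.d (n + 1) n) (g n) (by simp [hd, w])) :=
  have := (hS (n + 1)).epi_g
  isCokernelEpiComp (hS n).gIsCokernel (g (n + 1)) (hd n)

/-- The opcycles of a complex spliced from short exact sequences. -/
noncomputable def spliceOpcyclesIso (n : ℤ) : T.opcycles n ≅ O n :=
  (T.opcyclesIsCokernel (n + 1) n (by simp)).coconePointUniqueUpToIso (spliceIsColimit hS hd n)

lemma acyclic_of_splice : T.Acyclic := by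
  intro j
  obtain ⟨n, rfl⟩ : ∃ n, j = n + 1 := ⟨j - 1, by lia⟩
  rw [HomologicalComplex.exactAt_iff' _ (n + 1 + 1) (n + 1) n (by simp) (by simp)]
  have := (hS n).mono_f
  let φ : ShortComplex.mk (T.d (n + 1 + 1) (n + 1)) (g (n + 1)) (by simp [hd, w]) ⟶
      T.sc' (n + 1 + 1) (n + 1) n :=
    { τ₁ := 𝟙 _
      τ₂ := 𝟙 _
      τ₃ := f n
      comm₁₂ := (Category.id_comp _).trans (Category.comp_id _).symm
      comm₂₃ := (Category.id_comp _).trans (hd n) }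
  have : Epi φ.τ₁ := inferInstanceAs (Epi (𝟙 _))
  have : IsIso φ.τ₂ := inferInstanceAs (IsIso (𝟙 _))
  have : Mono φ.τ₃ := inferInstanceAs (Mono (f n))
  exact (ShortComplex.exact_iff_of_epi_of_isIso_of_mono φ).1
    (ShortComplex.exact_of_g_is_cokernel _ (spliceIsColimit hS hd (n + 1)))

end Splice

section Coresolution

open Abelian

variable {A : Type u} [Category.{v} A] [Abelian A] [HasExt.{w} A]

lemma ExtOrthogonal.opcycles {T : ChainComplex A ℤ} {B : A} (hT : T.Acyclic) (hB : HomExact T B)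
    (hX : ∀ i, ExtOrthogonal (T.X i) B) (i : ℤ) : ExtOrthogonal (T.opcycles i) B :=
  of_family (S := fun i => opcyclesShortComplex T (i + 1) i)
    (fun i => shortExact_opcyclesShortComplex T (by simp) (hT _))
    (fun i => ⟨i + 1, ⟨Iso.refl _⟩⟩) hX (fun i => (homExact_iff T B).1 hB i (i + 1) rfl) i

lemma homExact_of_extOrthogonal {T : ChainComplex A ℤ} {B : A} (hT : T.Acyclic)
    (hB : ∀ i, ExtOrthogonal (T.opcycles i) B) : HomExact T B :=
  (homExact_iff T B).2 fun i j hij =>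
    (hB i).exists_extension (shortExact_opcyclesShortComplex T (by simpa) (hT j))

/-- `P` is a class of projective objects of which every object is a quotient. -/
structure IsEnoughProjectives (P : ObjectProperty A) : Prop where
  projective : ∀ ⦃X : A⦄, P X → Projective X
  exists_epi : ∀ X : A, ∃ (Y : A) (p : Y ⟶ X), P Y ∧ Epi p

lemma IsEnoughProjectives.extOrthogonal {P : ObjectProperty A} (hP : IsEnoughProjectives P)
    {X : A} (hX : P X) (B : A) : ExtOrthogonal X B :=
  have := hP.projective hX
  .of_projective X B

/-- `M` admits a coresolution by objects of `Q` all of whose cosyzygies, including `M`, are left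
orthogonal to the class `F`. The coresolution is encoded coinductively: `W` is a class of objects
containing `M` in which every object has a cosyzygy with respect to `Q`. -/
def HasOrthogonalCoresolution (Q F : ObjectProperty A) (M : A) : Prop :=
  ∃ W : ObjectProperty A, W M ∧ (∀ N B, W N → F B → ExtOrthogonal N B) ∧
    ∀ N, W N → ∃ S : ShortComplex A, S.ShortExact ∧ Nonempty (N ≅ S.X₁) ∧ Q S.X₂ ∧ W S.X₃

variable {P Q F : ObjectProperty A}

namespace HasOrthogonalCoresolution

variable {M N : A} {S : ShortComplex A}

lemma extOrthogonal (h : HasOrthogonalCoresolution Q F M) {B : A} (hB : F B) :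
    ExtOrthogonal M B := by
  obtain ⟨W, hM, hF, -⟩ := h
  exact hF M B hM hB

lemma of_iso (e : M ≅ N) (h : HasOrthogonalCoresolution Q F N) :
    HasOrthogonalCoresolution Q F M := by
  obtain ⟨W, hN, hF, hQ⟩ := h
  refine ⟨W.isoClosure, ⟨N, hN, ⟨e⟩⟩, ?_, ?_⟩
  · rintro M B ⟨N, hN, ⟨e⟩⟩ hB
    exact (hF N B hN hB).of_iso e
  · rintro M ⟨N, hN, ⟨e⟩⟩
    obtain ⟨S, hS, ⟨e'⟩, hS₂, hS₃⟩ := hQ N hN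
    exact ⟨S, hS, ⟨e ≪≫ e'⟩, hS₂, W.le_isoClosure _ hS₃⟩

lemma exists_cokernel (h : HasOrthogonalCoresolution Q F M) :
    ∃ (E : A) (f : M ⟶ E), Mono f ∧ Q E ∧ HasOrthogonalCoresolution Q F (cokernel f) := by
  obtain ⟨W, hM, hF, hQ⟩ := h
  obtain ⟨S, hS, ⟨e⟩, hS₂, hS₃⟩ := hQ M hM
  have := hS.mono_f
  have := hS.epi_g
  refine ⟨S.X₂, e.hom ≫ S.f, inferInstance, hS₂, of_iso ?_ ⟨W, hS₃, hF, hQ⟩⟩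
  exact cokernelEpiComp e.hom S.f ≪≫
    (cokernelIsCokernel S.f).coconePointUniqueUpToIso hS.gIsCokernel

lemma of_shortExact (hS : S.ShortExact) (h₁ : ∀ B, F B → ExtOrthogonal S.X₁ B) (h₂ : Q S.X₂)
    (h₃ : HasOrthogonalCoresolution Q F S.X₃) : HasOrthogonalCoresolution Q F S.X₁ := by
  obtain ⟨W, hM, hF, hQ⟩ := h₃
  refine ⟨fun N => N = S.X₁ ∨ W N, .inl rfl, ?_, ?_⟩
  · rintro N B (rfl | hN) hB
    exacts [h₁ B hB, hF N B hN hB]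
  · rintro N (rfl | hN)
    · exact ⟨S, hS, ⟨Iso.refl _⟩, h₂, .inr hM⟩
    · obtain ⟨S', hS', e, h₂', h₃'⟩ := hQ N hN
      exact ⟨S', hS', e, h₂', .inr h₃'⟩

lemma of_mem [Q.ContainsZero] (hQF : ∀ X B, Q X → F B → ExtOrthogonal X B) (hM : Q M) :
    HasOrthogonalCoresolution Q F M := by
  obtain ⟨Z, hZ, hQZ⟩ := Q.exists_prop_of_containsZero
  refine ⟨Q, hM, hQF, fun N hN => ⟨.mk (𝟙 N) (0 : N ⟶ Z) comp_zero, ?_, ⟨Iso.refl _⟩, hN, hQZ⟩⟩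
  exact (ShortComplex.Splitting.ofIsIsoOfIsZero _ (inferInstanceAs (IsIso (𝟙 N))) hZ).shortExact

lemma of_isZero [Q.ContainsZero] (hQF : ∀ X B, Q X → F B → ExtOrthogonal X B) (hM : IsZero M) :
    HasOrthogonalCoresolution Q F M := by
  obtain ⟨Z, hZ, hQZ⟩ := Q.exists_prop_of_containsZero
  exact (of_mem hQF hQZ).of_iso (hM.iso hZ)

end HasOrthogonalCoresolution

lemma HasCompleteResolution.hasOrthogonalCoresolution (hP : IsEnoughProjectives P)
    (hQ : ∀ X B, Q X → F B → ExtOrthogonal X B) {M : A} (h : HasCompleteResolution P Q F M) :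
    HasOrthogonalCoresolution Q F M := by
  obtain ⟨T, hT, hTF, hTP, hTQ, ⟨e⟩⟩ := h
  refine .of_iso (e ≪≫ imageIsoOpcycles T hT (by simp)) ?_
  have hX {B : A} (hB : F B) (i : ℤ) : ExtOrthogonal (T.X i) B := by
    rcases le_or_gt 0 i with hi | hi
    · exact hP.extOrthogonal (hTP i hi) B
    · exact hQ _ _ (hTQ i hi) hB
  refine ⟨fun N => ∃ i ≤ (0 : ℤ), N = T.opcycles i, ⟨0, le_rfl, rfl⟩, ?_, ?_⟩
  · rintro _ B ⟨i, -, rfl⟩ hB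
    exact .opcycles hT (hTF B hB) (hX hB) i
  · rintro _ ⟨i, hi, rfl⟩
    exact ⟨opcyclesShortComplex T i (i - 1), shortExact_opcyclesShortComplex T (by simp) (hT i),
      ⟨Iso.refl _⟩, hTQ _ (by lia), i - 1, by lia, rfl⟩

lemma hasCompleteResolution_of_shortExact (O : ℤ → A)
    (hO : ∀ n B, F B → ExtOrthogonal (O n) B)
    (hS : ∀ n, ∃ S : ShortComplex A, S.ShortExact ∧ Nonempty (O (n + 1) ≅ S.X₁) ∧
      Nonempty (S.X₃ ≅ O n) ∧ (0 ≤ n → P S.X₂) ∧ (n < 0 → Q S.X₂)) :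
    HasCompleteResolution P Q F (O 0) := by
  choose S hS e₁ e₃ hP hQ using hS
  let f (n : ℤ) : O (n + 1) ⟶ (S n).X₂ := (e₁ n).some.hom ≫ (S n).f
  let g (n : ℤ) : (S n).X₂ ⟶ O n := (S n).g ≫ (e₃ n).some.hom
  have w (n : ℤ) : f n ≫ g n = 0 := by simp [f, g]
  have hfg (n : ℤ) : (ShortComplex.mk (f n) (g n) (w n)).ShortExact :=
    ShortComplex.shortExact_of_iso (ShortComplex.isoMk (e₁ n).some.symm (Iso.refl _)
      (e₃ n).some (by simp [f]) (by simp [g])) (hS n)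
  let T : ChainComplex A ℤ :=
    ChainComplex.of (fun n => (S n).X₂) (fun n => g (n + 1) ≫ f n) (by simp [reassoc_of% w])
  have hd (n : ℤ) : T.d (n + 1) n = g (n + 1) ≫ f n :=
    ChainComplex.of_d (fun n => (S n).X₂) (fun n => g (n + 1) ≫ f n) n
  have hT : T.Acyclic := acyclic_of_splice (T := T) hfg hd
  have e (n : ℤ) : T.opcycles n ≅ O n := spliceOpcyclesIso (T := T) hfg hd n
  exact ⟨T, hT, fun B hB => homExact_of_extOrthogonal hT fun n => (hO n B hB).of_iso (e n),
    hP, hQ, ⟨(imageIsoOpcycles T hT (by simp) ≪≫ e 0).symm⟩⟩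

lemma HasOrthogonalCoresolution.hasCompleteResolution (hP : IsEnoughProjectives P) {M : A}
    (h : HasOrthogonalCoresolution Q F M) : HasCompleteResolution P Q F M := by
  choose Y p hY hp using hP.exists_epi
  choose E f hf hE hL using fun N : Subtype (HasOrthogonalCoresolution (A := A) Q F) =>
    N.2.exists_cokernel
  let syz : ℕ → A := fun k => k.rec M fun _ N => kernel (p N)
  let cosyz : ℕ → Subtype (HasOrthogonalCoresolution Q F) :=
    fun k => k.rec ⟨M, h⟩ fun _ N => ⟨cokernel (f N), hL N⟩
  have hker (X : A) : (ShortComplex.mk _ _ (kernel.condition (p X))).ShortExact :=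
    { exact := ShortComplex.exact_kernel _ }
  have hcoker (N : Subtype (HasOrthogonalCoresolution Q F)) :
      (ShortComplex.mk _ _ (cokernel.condition (f N))).ShortExact :=
    { exact := ShortComplex.exact_cokernel _ }
  have hsyz (k : ℕ) (B : A) (hB : F B) : ExtOrthogonal (syz k) B := by
    induction k with
    | zero => exact h.extOrthogonal hB
    | succ k ih => exact .X₁ (hker (syz k)) (hP.extOrthogonal (hY (syz k)) B) ih
  refine hasCompleteResolution_of_shortExact
    (fun | .ofNat k => syz k | .negSucc k => cosyz (k + 1)) ?_ ?_
  · rintro (k | k) B hB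
    exacts [hsyz k B hB, (cosyz (k + 1)).2.extOrthogonal hB]
  · rintro (k | _ | k)
    · exact ⟨_, hker (syz k), ⟨Iso.refl _⟩, ⟨Iso.refl _⟩, fun _ => hY _, by lia⟩
    · exact ⟨_, hcoker (cosyz 0), ⟨Iso.refl _⟩, ⟨Iso.refl _⟩, by lia, fun _ => hE _⟩
    · exact ⟨_, hcoker (cosyz (k + 1)), ⟨Iso.refl _⟩, ⟨Iso.refl _⟩, by lia, fun _ => hE _⟩

end Coresolution

section Snake

variable {A : Type u} [Category.{v} A] [Abelian A]

lemma shortExact_cokernel {S₁ S₂ : ShortComplex A} (h₁ : S₁.ShortExact) (h₂ : S₂.ShortExact)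
    (φ : S₁ ⟶ S₂) [Mono φ.τ₃] : (cokernel φ).ShortExact := by
  let D : ShortComplex.SnakeInput A :=
    { L₀ := kernel φ, L₁ := S₁, L₂ := S₂, L₃ := cokernel φ
      v₀₁ := kernel.ι φ, v₁₂ := φ, v₂₃ := cokernel.π φ
      w₀₂ := kernel.condition φ, w₁₃ := cokernel.condition φ
      h₀ := kernelIsKernel φ
      h₃ := cokernelIsCokernel φ
      L₁_exact := h₁.exact, epi_L₁_g := h₁.epi_g
      L₂_exact := h₂.exact, mono_L₂_f := h₂.mono_f }
  have hL₀ : IsZero D.L₀.X₃ := KernelFork.IsLimit.isZero_of_mono D.h₀τ₃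
  have : Epi D.L₂.g := h₂.epi_g
  exact
    { exact := D.L₃_exact
      mono_f := (D.L₂'.exact_iff_mono (hL₀.eq_of_src _ _)).1 D.L₂'_exact
      epi_g := D.epi_L₃_g }

end Snake

section Closure

open scoped ZeroObject

variable {A : Type u} [Category.{v} A] [Abelian A]

lemma isClosedUnderBinaryProducts_of_biprod (Q : ObjectProperty A) [Q.IsClosedUnderIsomorphisms]
    (h : ∀ X Y, Q X → Q Y → Q (X ⊞ Y)) : Q.IsClosedUnderBinaryProducts :=
  .mk' <| by
    rintro _ ⟨F, hF⟩
    exact Q.prop_of_iso ((biprod.isoProd _ _).trans (HasLimit.isoOfNatIso (diagramIsoPair F)).symm)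
      (h _ _ (hF ⟨.left⟩) (hF ⟨.right⟩))

lemma prop_biprod (Q : ObjectProperty A) [Q.IsClosedUnderBinaryProducts] {X Y : A} (hX : Q X)
    (hY : Q Y) : Q (X ⊞ Y) :=
  Q.prop_of_isLimit_binaryFan (BinaryBiproduct.isLimit X Y) hX hY

lemma shortExact_cokernel_π {S₁ S₂ : ShortComplex A} (h₁ : S₁.ShortExact)
    (h₂ : S₂.ShortExact) (φ : S₁ ⟶ S₂) [Mono φ.τ₁] [Mono φ.τ₃] :
    (ShortComplex.mk φ.τ₂ (cokernel.π φ).τ₂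
      ((ShortComplex.comp_τ₂ _ _).symm.trans
        (congrArg ShortComplex.Hom.τ₂ (cokernel.condition φ)))).ShortExact where
  exact := (ShortComplex.exact_cokernel φ).map ShortComplex.π₂
  mono_f :=
    have := h₁.mono_f
    have := h₂.mono_f
    ShortComplex.mono_τ₂_of_exact_of_mono φ h₁.exact
  epi_g := inferInstanceAs (Epi (ShortComplex.π₂.map (cokernel.π φ)))

variable [HasExt.{w} A] {Q F : ObjectProperty A} {S : ShortComplex A}

namespace HasOrthogonalCoresolution

lemma exists_mono_to_biprod [Q.IsClosedUnderBinaryProducts] (hS : S.ShortExact)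
    (h₁ : HasOrthogonalCoresolution Q F S.X₁) (h₃ : HasOrthogonalCoresolution Q F S.X₃)
    (hQF : Q ≤ F) :
    ∃ (S' : ShortComplex A) (φ : S ⟶ S'), S'.ShortExact ∧ Mono φ.τ₁ ∧ Mono φ.τ₃ ∧ Q S'.X₂ ∧
      HasOrthogonalCoresolution Q F (cokernel φ).X₁ ∧
      HasOrthogonalCoresolution Q F (cokernel φ).X₃ := by
  obtain ⟨E₁, a, ha, hE₁, hC₁⟩ := h₁.exists_cokernel
  obtain ⟨E₃, b, hb, hE₃, hC₃⟩ := h₃.exists_cokernel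
  obtain ⟨e, he⟩ := (h₃.extOrthogonal (hQF _ hE₁)).exists_extension hS a
  let φ : S ⟶ .mk (biprod.inl : E₁ ⟶ E₁ ⊞ E₃) biprod.snd biprod.inl_snd :=
    { τ₁ := a
      τ₂ := biprod.lift e (S.g ≫ b)
      τ₃ := b
      comm₁₂ := by apply biprod.hom_ext <;> simp [he]
      comm₂₃ := by simp }
  exact ⟨_, φ, (ShortComplex.Splitting.ofHasBinaryBiproduct E₁ E₃).shortExact, ha, hb,
    prop_biprod Q hE₁ hE₃, hC₁.of_iso (PreservesCokernel.iso ShortComplex.π₁ φ),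
    hC₃.of_iso (PreservesCokernel.iso ShortComplex.π₃ φ)⟩

lemma X₂ [Q.IsClosedUnderBinaryProducts] (hS : S.ShortExact)
    (h₁ : HasOrthogonalCoresolution Q F S.X₁) (h₃ : HasOrthogonalCoresolution Q F S.X₃)
    (hQF : Q ≤ F) : HasOrthogonalCoresolution Q F S.X₂ := by
  refine ⟨fun N => ∃ S : ShortComplex A, S.ShortExact ∧ HasOrthogonalCoresolution Q F S.X₁ ∧
    HasOrthogonalCoresolution Q F S.X₃ ∧ N = S.X₂, ⟨S, hS, h₁, h₃, rfl⟩, ?_, ?_⟩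
  · rintro _ B ⟨S, hS, h₁, h₃, rfl⟩ hB
    exact .X₂ hS (h₁.extOrthogonal hB) (h₃.extOrthogonal hB)
  · rintro _ ⟨S, hS, h₁, h₃, rfl⟩
    obtain ⟨S', φ, hS', _, _, hQ, hC₁, hC₃⟩ := exists_mono_to_biprod hS h₁ h₃ hQF
    exact ⟨_, shortExact_cokernel_π hS hS' φ, ⟨Iso.refl _⟩, hQ,
      ⟨_, shortExact_cokernel hS hS' φ, hC₁, hC₃, rfl⟩⟩

lemma X₁ [Q.IsClosedUnderBinaryProducts] (hS : S.ShortExact)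
    (h₂ : HasOrthogonalCoresolution Q F S.X₂) (h₃ : HasOrthogonalCoresolution Q F S.X₃)
    (hQF : Q ≤ F) : HasOrthogonalCoresolution Q F S.X₁ := by
  obtain ⟨E, f, hf, hE, hC⟩ := h₂.exists_cokernel
  have := hS.mono_f
  have hf' : (ShortComplex.mk _ _ (cokernel.condition f)).ShortExact :=
    { exact := ShortComplex.exact_cokernel f }
  have hid : (ShortComplex.mk (𝟙 S.X₁) (0 : S.X₁ ⟶ (0 : A)) comp_zero).ShortExact :=
    (ShortComplex.Splitting.ofIsIsoOfIsZero _ (inferInstanceAs (IsIso (𝟙 S.X₁)))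
      (isZero_zero A)).shortExact
  let φ : ShortComplex.mk (𝟙 S.X₁) (0 : S.X₁ ⟶ (0 : A)) comp_zero ⟶
      ShortComplex.mk _ _ (cokernel.condition f) :=
    { τ₁ := S.f
      τ₂ := S.f ≫ f
      τ₃ := 0
      comm₁₂ := (Category.id_comp _).symm
      comm₂₃ := by simp }
  have : Mono φ.τ₁ := inferInstanceAs (Mono S.f)
  have : Mono φ.τ₃ := inferInstanceAs (Mono (0 : (0 : A) ⟶ _))
  have horth (B : A) (hB : F B) : ExtOrthogonal S.X₁ B :=
    .X₁ hS (h₂.extOrthogonal hB) (h₃.extOrthogonal hB)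
  have hcoker : HasOrthogonalCoresolution Q F (cokernel φ).X₂ := by
    refine .X₂ (shortExact_cokernel hid hf' φ) (h₃.of_iso ?_) (hC.of_iso ?_) hQF
    · exact PreservesCokernel.iso ShortComplex.π₁ φ ≪≫
        (cokernelIsCokernel S.f).coconePointUniqueUpToIso hS.gIsCokernel
    · exact PreservesCokernel.iso ShortComplex.π₃ φ ≪≫ cokernelZeroIsoTarget
  exact (of_shortExact (shortExact_cokernel_π hid hf' φ) horth hE hcoker :)

lemma X₃ [Q.IsClosedUnderBinaryProducts] [Q.ContainsZero] (hS : S.ShortExact)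
    (h₁ : HasOrthogonalCoresolution Q F S.X₁) (h₂ : HasOrthogonalCoresolution Q F S.X₂)
    (h₃ : ∀ B, F B → Subsingleton (Abelian.Ext S.X₃ B 1)) (hQF : Q ≤ F)
    (hQ : ∀ X B, Q X → F B → ExtOrthogonal X B) : HasOrthogonalCoresolution Q F S.X₃ := by
  obtain ⟨E, a, ha, hE, hC⟩ := h₁.exists_cokernel
  obtain ⟨e, he⟩ := exists_extension_of_ext_one hS (h₃ E (hQF E hE)) a
  have hsplit := (ShortComplex.Splitting.ofHasBinaryBiproduct E S.X₃).shortExact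
  let φ : S ⟶ .mk (biprod.inl : E ⟶ E ⊞ S.X₃) biprod.snd biprod.inl_snd :=
    { τ₁ := a
      τ₂ := biprod.lift e S.g
      τ₃ := 𝟙 _
      comm₁₂ := by apply biprod.hom_ext <;> simp [he]
      comm₂₃ := by simp }
  have : Mono φ.τ₃ := inferInstanceAs (Mono (𝟙 _))
  have hpushout : HasOrthogonalCoresolution Q F (E ⊞ S.X₃) := by
    refine .X₂ (shortExact_cokernel_π hS hsplit φ) h₂
      (.X₂ (shortExact_cokernel hS hsplit φ) (hC.of_iso ?_) (of_isZero hQ ?_) hQF) hQF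
    · exact PreservesCokernel.iso ShortComplex.π₁ φ
    · have : Epi (ShortComplex.π₃.map φ) := inferInstanceAs (Epi (𝟙 _))
      exact (isZero_cokernel_of_epi _).of_iso (PreservesCokernel.iso ShortComplex.π₃ φ)
  have hsplit' := (ShortComplex.Splitting.ofHasBinaryBiproduct S.X₃ E).shortExact
  exact .X₁ hsplit' (hpushout.of_iso (biprod.braiding _ _)) (of_mem hQ hE) hQF

end HasOrthogonalCoresolution

end Closure

section Contractible

variable {A : Type u} [Category.{v} A] [Abelian A]

/-- The complex with `M i ⊞ M (i - 1)` in degree `i`, whose differential is the identity of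
`M (i - 1)`. Mapping out of it or into it amounts to giving one morphism in each degree: up to a
shift, it is the value at `M` of both adjoints of the functor forgetting the differentials. -/
noncomputable def contractible (M : ℤ → A) : ChainComplex A ℤ where
  X i := M i ⊞ M (i - 1)
  d i j := if h : i - 1 = j then biprod.snd ≫ eqToHom (congrArg M h) ≫ biprod.inl else 0
  shape i j hij := dif_neg fun h => hij (by simp [← h])
  d_comp_d' i j k hij hjk := by
    obtain rfl : i - 1 = j := by simp at hij; lia
    obtain rfl : i - 1 - 1 = k := by simp at hjk; lia
    simp

namespace contractible

variable {M N : ℤ → A} {K : ChainComplex A ℤ}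

/-- The terms of `contractible M`, which is to be used through this isomorphism. -/
noncomputable def XIso (M : ℤ → A) (i : ℤ) : (contractible M).X i ≅ M i ⊞ M (i - 1) :=
  Iso.refl _

/-- The projection through which morphisms into `contractible M` are determined. -/
noncomputable def fst (M : ℤ → A) (i : ℤ) : (contractible M).X i ⟶ M i :=
  (XIso M i).hom ≫ biprod.fst

/-- The inclusion through which morphisms out of `contractible M` are determined. -/
noncomputable def inr (M : ℤ → A) (i : ℤ) : M (i - 1) ⟶ (contractible M).X i :=
  biprod.inr ≫ (XIso M i).inv

lemma d_eq (M : ℤ → A) (i : ℤ) : (contractible M).d i (i - 1) =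
    (XIso M i).hom ≫ biprod.snd ≫ biprod.inl ≫ (XIso M (i - 1)).inv := by
  simp [contractible, XIso]

lemma hom_ext_fst {f g : K ⟶ contractible M} (h : ∀ i, f.f i ≫ fst M i = g.f i ≫ fst M i) :
    f = g := by
  ext i
  rw [← cancel_mono (XIso M i).hom]
  apply biprod.hom_ext
  · simpa [fst] using h i
  · have hd : (contractible M).d i (i - 1) ≫ fst M (i - 1) = (XIso M i).hom ≫ biprod.snd := by
      simp [d_eq, fst]
    simp only [Category.assoc, ← hd, f.comm_assoc, g.comm_assoc, h]

lemma hom_ext_inr {f g : contractible M ⟶ K} (h : ∀ i, inr M i ≫ f.f i = inr M i ≫ g.f i) :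
    f = g := by
  ext i
  rw [← cancel_epi (XIso M i).inv]
  apply biprod.hom_ext'
  · obtain ⟨i, rfl⟩ : ∃ j, i = j - 1 := ⟨i + 1, by lia⟩
    have hd : inr M i ≫ (contractible M).d i (i - 1) = biprod.inl ≫ (XIso M (i - 1)).inv := by
      simp [d_eq, inr]
    simp only [← reassoc_of% hd, ← f.comm, ← g.comm, reassoc_of% (h i)]
  · simpa [inr] using h i

/-- The morphism into `contractible M` with the given components along `fst`. -/
noncomputable def lift (φ : ∀ i, K.X i ⟶ M i) : K ⟶ contractible M where
  f i := biprod.lift (φ i) (K.d i (i - 1) ≫ φ (i - 1)) ≫ (XIso M i).inv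
  comm' i j hij := by
    obtain rfl : i - 1 = j := by simp at hij; lia
    rw [← cancel_mono (XIso M (i - 1)).hom]
    apply biprod.hom_ext <;> simp [d_eq]

@[simp]
lemma lift_fst (φ : ∀ i, K.X i ⟶ M i) (i : ℤ) : (lift φ).f i ≫ fst M i = φ i := by
  simp [lift, fst]

/-- The morphism out of `contractible M` with the given components along `inr`. Having both indices
in the family `ψ` avoids transports along `i - 1 + 1 = i`. -/
noncomputable def desc (ψ : ∀ i j, i + 1 = j → (M i ⟶ K.X j)) : contractible M ⟶ K where
  f i := (XIso M i).hom ≫ biprod.desc (ψ i (i + 1) rfl ≫ K.d (i + 1) i) (ψ (i - 1) i (by simp))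
  comm' i j hij := by
    obtain rfl : i - 1 = j := by simp at hij; lia
    have hψ : ∀ j (h : i - 1 + 1 = j), ψ (i - 1) j h ≫ K.d j (i - 1) =
        ψ (i - 1) (i - 1 + 1) rfl ≫ K.d (i - 1 + 1) (i - 1) := by rintro _ rfl; rfl
    rw [← cancel_epi (XIso M i).inv]
    apply biprod.hom_ext' <;> simp [d_eq, hψ i]

@[simp]
lemma inr_desc (ψ : ∀ i j, i + 1 = j → (M i ⟶ K.X j)) (i : ℤ) :
    inr M i ≫ (desc ψ).f i = ψ (i - 1) i (by simp) := by
  simp [desc, inr]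

lemma lift_f_desc_f {L : ChainComplex A ℤ} (φ : ∀ i, K.X i ⟶ M i)
    (ψ : ∀ i j, i + 1 = j → (M i ⟶ L.X j)) (i : ℤ) : (lift φ).f i ≫ (desc ψ).f i =
      φ i ≫ ψ i (i + 1) rfl ≫ L.d (i + 1) i +
        K.d i (i - 1) ≫ φ (i - 1) ≫ ψ (i - 1) i (by simp) := by
  simp [lift, desc]

lemma exists_hom (ψ : ∀ i, M (i - 1) ⟶ K.X i) :
    ∃ f : contractible M ⟶ K, ∀ i, inr M i ≫ f.f i = ψ i :=
  ⟨desc fun i j h => eqToHom (by rw [← h, add_sub_cancel_right]) ≫ ψ j, fun i => by simp⟩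

/-- The functoriality of `contractible`. -/
noncomputable def map (t : ∀ i, M i ⟶ N i) : contractible M ⟶ contractible N :=
  lift fun i => fst M i ≫ t i

lemma map_fst (t : ∀ i, M i ⟶ N i) (i : ℤ) : (map t).f i ≫ fst N i = fst M i ≫ t i :=
  lift_fst _ _

lemma inr_map (t : ∀ i, M i ⟶ N i) (i : ℤ) : inr M i ≫ (map t).f i = t (i - 1) ≫ inr N i := by
  rw [← cancel_mono (XIso N i).hom]
  apply biprod.hom_ext <;> simp [map, lift, d_eq, fst, inr]

lemma mono_map (t : ∀ i, M i ⟶ N i) [∀ i, Mono (t i)] : Mono (map t) where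
  right_cancellation f g h := hom_ext_fst fun i => by
    rw [← cancel_mono (t i), Category.assoc, Category.assoc, ← map_fst,
      ← HomologicalComplex.comp_f_assoc, ← HomologicalComplex.comp_f_assoc, h]

lemma epi_map (t : ∀ i, M i ⟶ N i) [∀ i, Epi (t i)] : Epi (map t) where
  left_cancellation f g h := hom_ext_inr fun i => by
    rw [← cancel_epi (t (i - 1)), ← reassoc_of% inr_map, ← reassoc_of% inr_map,
      ← HomologicalComplex.comp_f, ← HomologicalComplex.comp_f, h]

lemma shortExact_map {S : ℤ → ShortComplex A} (hS : ∀ i, (S i).ShortExact) :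
    (ShortComplex.mk (map fun i => (S i).f) (map fun i => (S i).g) (hom_ext_fst fun i => by
      simp [map_fst, reassoc_of% map_fst])).ShortExact := by
  have (i : ℤ) : Mono (S i).f := (hS i).mono_f
  have (i : ℤ) : Epi (S i).g := (hS i).epi_g
  have := mono_map fun i => (S i).f
  refine .mk' (ShortComplex.exact_of_f_is_kernel _ <| KernelFork.IsLimit.ofι' _ _
    fun {X} x hx => ?_) (mono_map _) (epi_map _)
  have hx' (i : ℤ) : (x.f i ≫ fst _ i) ≫ (S i).g = 0 := by
    rw [Category.assoc, ← map_fst fun i => (S i).g, ← HomologicalComplex.comp_f_assoc]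
    simp [hx]
  exact ⟨lift fun i => (hS i).exact.lift _ (hx' i), hom_ext_fst fun i => by
    rw [HomologicalComplex.comp_f, Category.assoc, map_fst, reassoc_of% lift_fst,
      (hS i).exact.lift_f]⟩

lemma projective (hM : ∀ i, Projective (M i)) : Projective (contractible M) where
  factors {E X} f e he := by
    have (i : ℤ) : Epi (e.f i) := inferInstance
    obtain ⟨g, hg⟩ := exists_hom fun i => Projective.factorThru (inr M i ≫ f.f i) (e.f i)
    exact ⟨g, hom_ext_inr fun i => by simp [reassoc_of% (hg i)]⟩

/-- The cycles of `contractible M` in degree `i` are the summand `M i`. -/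
noncomputable def cyclesIso (M : ℤ → A) (i : ℤ) : (contractible M).cycles i ≅ M i :=
  ((contractible M).cyclesIsKernel i (i - 1) (by simp)).conePointUniqueUpToIso <|
    KernelFork.IsLimit.ofι (biprod.inl ≫ (XIso M i).inv) (by simp [d_eq])
      (fun x _ => x ≫ fst M i)
      (fun x hx => by
        have hx' : x ≫ (XIso M i).hom ≫ biprod.snd = 0 := by
          simpa [d_eq, fst] using hx =≫ fst M (i - 1)
        rw [← cancel_mono (XIso M i).hom]
        apply biprod.hom_ext <;> simp [hx', fst])
      (fun x _ y hy => by simp [← hy, fst])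

variable (M) in
lemma acyclic : (contractible M).Acyclic := by
  intro j
  obtain ⟨i, rfl⟩ : ∃ i, j = i - 1 := ⟨j + 1, by lia⟩
  rw [HomologicalComplex.exactAt_iff' _ i (i - 1) (i - 1 - 1) (by simp) (by simp),
    ShortComplex.exact_iff_exact_up_to_refinements]
  intro X (x : X ⟶ (contractible M).X (i - 1))
    (hx : x ≫ (contractible M).d (i - 1) (i - 1 - 1) = 0)
  have hx' : x ≫ (XIso M (i - 1)).hom ≫ biprod.snd = 0 := by
    simpa [d_eq, fst] using hx =≫ fst M (i - 1 - 1)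
  have hx'' : x = (x ≫ fst M (i - 1) ≫ inr M i) ≫ (contractible M).d i (i - 1) := by
    rw [← cancel_mono (XIso M (i - 1)).hom]
    apply biprod.hom_ext <;> simp [hx', d_eq, fst, inr]
  exact ⟨X, 𝟙 X, inferInstance, _, (Category.id_comp _).trans hx''⟩

lemma mem_tildeClass {𝒳 : ObjectProperty A} [𝒳.IsClosedUnderIsomorphisms] (hM : ∀ i, 𝒳 (M i)) :
    tildeClass 𝒳 (contractible M) :=
  ⟨acyclic M, fun i => 𝒳.prop_of_iso (cyclesIso M i).symm (hM i)⟩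

end contractible

end Contractible

section CyclesSplitting

variable {A : Type u} [Category.{v} A] [Abelian A] {K : ChainComplex A ℤ}

/-- A complex with split sequences of cycles, as a retract of the contractible complex on its
cycles. The inclusion is given by the retractions of the splittings and the projection by their
sections. -/
noncomputable def retractContractible
    (σ : ∀ i j, i + 1 = j → (cyclesShortComplex K j i).Splitting) :
    Retract K (contractible fun i => K.cycles i) where
  i := contractible.lift fun j => (σ (j - 1) j (by simp)).r
  r := contractible.desc fun i j hij => (σ i j hij).s
  retract := by
    ext i
    have hs := (σ i (i + 1) rfl).s_g =≫ K.iCycles i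
    have hr := K.toCycles i (i - 1) ≫= (σ (i - 1 - 1) (i - 1) (by simp)).f_r
    simp only [Category.assoc, K.toCycles_i, K.toCycles_i_assoc, Category.id_comp,
      Category.comp_id] at hs hr
    simpa [contractible.lift_f_desc_f, hs, reassoc_of% hr] using (σ (i - 1) i _).id

variable [HasExt.{w} A] {𝒳 : ObjectProperty A}

lemma tildeClass.nonempty_splitting (h𝒳 : ∀ X Y, 𝒳 X → 𝒳 Y → ExtOrthogonal X Y)
    (hK : tildeClass 𝒳 K) {i j : ℤ} (hij : i + 1 = j) :
    Nonempty (cyclesShortComplex K j i).Splitting := by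
  have hS := shortExact_cyclesShortComplex K (by simpa) (hK.1 i)
  obtain ⟨r, hr⟩ := (h𝒳 _ _ (hK.2 i) (hK.2 j)).exists_extension hS (𝟙 _)
  exact ⟨.ofExactOfRetraction _ hS.exact r hr hS.epi_g⟩

lemma tildeClass.X [𝒳.IsClosedUnderIsomorphisms] [𝒳.IsClosedUnderBinaryProducts]
    (h𝒳 : ∀ X Y, 𝒳 X → 𝒳 Y → ExtOrthogonal X Y) (hK : tildeClass 𝒳 K) (j : ℤ) : 𝒳 (K.X j) := by
  obtain ⟨σ⟩ := hK.nonempty_splitting h𝒳 (sub_add_cancel j 1)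
  exact 𝒳.prop_of_iso σ.isoBinaryBiproduct.symm (prop_biprod 𝒳 (hK.2 j) (hK.2 (j - 1)))

lemma tildeClass.nonempty_retract (h𝒳 : ∀ X Y, 𝒳 X → 𝒳 Y → ExtOrthogonal X Y)
    (hK : tildeClass 𝒳 K) : Nonempty (Retract K (contractible fun i => K.cycles i)) :=
  ⟨retractContractible fun _ _ hij => (hK.nonempty_splitting h𝒳 hij).some⟩

end CyclesSplitting

section TildeClasses

variable {A : Type u} [Category.{v} A] [Abelian A]

section Orthogonality

variable [HasExt.{w} A] [HasExt.{w} (ChainComplex A ℤ)]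

lemma ExtOrthogonal.contractible_left [EnoughProjectives A] (H : ChainComplex A ℤ) {M : ℤ → A}
    (hM : ∀ i, ExtOrthogonal (M (i - 1)) (H.X i)) : ExtOrthogonal (contractible M) H := by
  have hS (M : ℤ → A) (i : ℤ) := shortExact_syzygyShortComplex (M i)
  refine of_family (ι := {M : ℤ → A // ∀ i, ExtOrthogonal (M (i - 1)) (H.X i)})
    (fun M => contractible.shortExact_map (hS M.1)) (fun M => ?_) (fun M => ?_) (fun M φ => ?_)
    ⟨M, hM⟩
  · exact ⟨⟨fun i => kernel (Projective.π (M.1 i)),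
      fun i => X₁ (hS M.1 (i - 1)) (of_projective _ _) (M.2 i)⟩, ⟨Iso.refl _⟩⟩
  · have : Projective (contractible fun i => Projective.over (M.1 i)) :=
      contractible.projective fun i => inferInstance
    exact of_projective _ _
  · choose ψ hψ using fun i => exists_extension (hS M.1 (i - 1)) (M.2 i)
      (contractible.inr (fun i => kernel (Projective.π (M.1 i))) i ≫ φ.f i)
    obtain ⟨g, hg⟩ := contractible.exists_hom (M := fun i => Projective.over (M.1 i)) ψ
    exact ⟨g, contractible.hom_ext_inr fun i => by
      rw [HomologicalComplex.comp_f, reassoc_of% contractible.inr_map, hg, hψ]⟩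

variable {Q F : ObjectProperty A}

omit [HasExt.{w} (ChainComplex A ℤ)] in
lemma tildeClass.extOrthogonal_X {M : A} (hM : ∀ B, F B → ExtOrthogonal M B)
    {H : ChainComplex A ℤ} (hH : tildeClass F H) (i : ℤ) : ExtOrthogonal M (H.X i) :=
  .right_X₂ (shortExact_cyclesShortComplex H (i := i - 1) (by simp) (hH.1 _))
    (hM _ (hH.2 _)) (hM _ (hH.2 _))

lemma tildeClass.extOrthogonal [EnoughProjectives A] (hQ : ∀ X Y, Q X → Q Y → ExtOrthogonal X Y)
    (hF : ∀ X B, Q X → F B → ExtOrthogonal X B) {K H : ChainComplex A ℤ} (hK : tildeClass Q K)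
    (hH : tildeClass F H) : ExtOrthogonal K H := by
  obtain ⟨r⟩ := hK.nonempty_retract hQ
  exact .of_retract r (.contractible_left H fun i => extOrthogonal_X (hF _ · (hK.2 _)) hH i)

end Orthogonality

variable (𝒳 : ObjectProperty A)

instance [𝒳.IsClosedUnderIsomorphisms] : (tildeClass 𝒳).IsClosedUnderIsomorphisms where
  of_iso e h := ⟨fun i => (h.1 i).of_iso e,
    fun i => 𝒳.prop_of_iso (HomologicalComplex.cyclesMapIso e i) (h.2 i)⟩

instance [𝒳.ContainsZero] [𝒳.IsClosedUnderIsomorphisms] : (tildeClass 𝒳).ContainsZero where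
  exists_zero := ⟨HomologicalComplex.zero, HomologicalComplex.isZero_zero, fun i => by
      rw [HomologicalComplex.exactAt_iff_isZero_homology]
      exact (HomologicalComplex.homologyFunctor A _ i).map_isZero HomologicalComplex.isZero_zero,
    fun i => 𝒳.prop_of_isZero <|
      (HomologicalComplex.cyclesFunctor A _ i).map_isZero HomologicalComplex.isZero_zero⟩

instance (i : ℤ) : (HomologicalComplex.cyclesFunctor A (ComplexShape.down ℤ) i).Additive where
  map_add {_ _ f g} := ShortComplex.cyclesMap_add
    ((HomologicalComplex.shortComplexFunctor A _ i).map f)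
    ((HomologicalComplex.shortComplexFunctor A _ i).map g)

instance [𝒳.IsClosedUnderIsomorphisms] [𝒳.IsClosedUnderBinaryProducts] :
    (tildeClass 𝒳).IsClosedUnderBinaryProducts := by
  refine isClosedUnderBinaryProducts_of_biprod _ fun K L hK hL => ⟨?_, fun i => ?_⟩
  · exact (ShortComplex.Splitting.ofHasBinaryBiproduct K L).shortExact.acyclic_X₂ hK.1 hL.1
  · have : PreservesBinaryBiproduct K L
        (HomologicalComplex.cyclesFunctor A (ComplexShape.down ℤ) i) :=
      preservesBinaryBiproduct_of_preservesBiproduct _ _ _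
    exact 𝒳.prop_of_iso
      ((HomologicalComplex.cyclesFunctor A (ComplexShape.down ℤ) i).mapBiprod K L).symm
      (prop_biprod 𝒳 (hK.2 i) (hL.2 i))

end TildeClasses

section Shift

variable {A : Type u} [Category.{v} A] [Abelian A]

/-- The reindexing of `ℤ`-indexed chain complexes by `i ↦ i + 1`. -/
def shiftEmbedding : (ComplexShape.down ℤ).Embedding (ComplexShape.down ℤ) :=
  .mk' _ _ (· + 1) (add_left_injective 1) (by simp)

instance : shiftEmbedding.IsRelIff :=
  inferInstanceAs (ComplexShape.Embedding.mk' _ _ _ _ _).IsRelIff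

/-- The shift of `H`, with `H.X (i + 1)` in degree `i` and, unlike the usual suspension, the same
differential as `H`. -/
abbrev shift (H : ChainComplex A ℤ) : ChainComplex A ℤ :=
  H.restriction shiftEmbedding

lemma tildeClass.shift {𝒳 : ObjectProperty A} [𝒳.IsClosedUnderIsomorphisms]
    {H : ChainComplex A ℤ} (hH : tildeClass 𝒳 H) : tildeClass 𝒳 (shift H) := by
  have hf (i : ℤ) : shiftEmbedding.f i = i + 1 := rfl
  refine ⟨fun i => ?_, fun i => ?_⟩
  · rw [HomologicalComplex.exactAt_iff_isZero_homology]
    exact (hH.1 (i + 1)).isZero_homology.of_iso <|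
      H.restrictionHomologyIso shiftEmbedding (i + 1) i (i - 1) (by simp) (by simp) rfl rfl rfl
        (by simp [hf]) (by simp [hf])
  · exact 𝒳.prop_of_iso (H.restrictionCyclesIso shiftEmbedding i (i - 1) (by simp) rfl rfl
      (by simp [hf])).symm (hH.2 (i + 1))

end Shift

section ShiftShortComplex

variable {A : Type u} [Category.{v} A] [Abelian A] {H K : ChainComplex A ℤ}
  (τ : ∀ i j, i + 1 = j → (K.X i ≅ H.X j))
  (hτ : ∀ i j (hij : i + 1 = j),
    (τ i j hij).hom ≫ H.d j i = K.d i (i - 1) ≫ (τ (i - 1) i (by simp)).hom)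

/-- A shift `K` of `H` is a syzygy of `H` with respect to contractible complexes. The signs are
needed because `τ` commutes with the differentials, rather than anticommuting with them. -/
noncomputable abbrev shiftShortComplex : ShortComplex (ChainComplex A ℤ) :=
  .mk (contractible.lift fun i => i.negOnePow • 𝟙 (K.X i))
    (contractible.desc fun i j hij => (τ i j hij).hom) <| by
      ext i
      simp [contractible.lift_f_desc_f, hτ, Int.negOnePow_sub]

lemma shortExact_shiftShortComplex : (shiftShortComplex τ hτ).ShortExact := by
  refine HomologicalComplex.shortExact_of_degreewise_shortExact _ fun i => ?_
  have hr : (shiftShortComplex τ hτ).f.f i ≫ (i.negOnePow • contractible.fst K.X i) = 𝟙 _ := by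
    simp [smul_smul]
  have hs : ((τ (i - 1) i (by simp)).inv ≫ contractible.inr K.X i) ≫
      (shiftShortComplex τ hτ).g.f i = 𝟙 _ := by
    simp
  have hid : (i.negOnePow • contractible.fst K.X i) ≫ (shiftShortComplex τ hτ).f.f i +
      (shiftShortComplex τ hτ).g.f i ≫ (τ (i - 1) i (by simp)).inv ≫ contractible.inr K.X i =
        𝟙 _ := by
    rw [← cancel_epi (contractible.XIso K.X i).inv, ← cancel_mono (contractible.XIso K.X i).hom]
    apply biprod.hom_ext' <;> apply biprod.hom_ext <;>
      simp [contractible.lift, contractible.desc, contractible.fst, contractible.inr, smul_smul,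
        reassoc_of% hτ, Int.negOnePow_sub]
  exact (ShortComplex.Splitting.mk _ _ hr hs hid).shortExact

end ShiftShortComplex

section DegreewiseExt

variable {A : Type u} [Category.{v} A] [Abelian A]

/-- The terms of `shift H`, with a free index `j` for `i + 1`. -/
noncomputable def shiftXIso (H : ChainComplex A ℤ) (i j : ℤ) (hij : i + 1 = j) :
    (shift H).X i ≅ H.X j :=
  H.restrictionXIso shiftEmbedding hij

lemma shiftXIso_hom_comp_d (H : ChainComplex A ℤ) (i j : ℤ) (hij : i + 1 = j) :
    (shiftXIso H i j hij).hom ≫ H.d j i =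
      (shift H).d i (i - 1) ≫ (shiftXIso H (i - 1) i (by simp)).hom := by
  rw [H.restriction_d_eq shiftEmbedding hij (sub_add_cancel i 1), Category.assoc, Category.assoc]
  exact congrArg (_ ≫ ·) ((Category.comp_id _).symm.trans <| congrArg (_ ≫ ·) <|
    (Iso.inv_hom_id _).symm)

variable [HasExt.{w} A] [HasExt.{w} (ChainComplex A ℤ)]

/-- To extend `X₁ ⟶ H` to `X₂`, lift it along the contractible complex covering `H`, extend the
lift degreewise, and project. -/
lemma ext_one_of_degreewise {S : ShortComplex (ChainComplex A ℤ)} (hS : S.ShortExact)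
    {H : ChainComplex A ℤ} (h₁ : Subsingleton (Abelian.Ext S.X₁ (shift H) 1))
    (h₂ : Subsingleton (Abelian.Ext S.X₂ H 1))
    (h₃ : ∀ i, Subsingleton (Abelian.Ext (S.X₃.X i) ((shift H).X i) 1)) :
    Subsingleton (Abelian.Ext S.X₃ H 1) := by
  refine ext_one_of_exists_extension hS h₂ fun φ => ?_
  obtain ⟨φ', hφ'⟩ := exists_lift_of_ext_one
    (shortExact_shiftShortComplex _ (shiftXIso_hom_comp_d H)) h₁ φ
  have hψ (i : ℤ) : ∃ ψ : S.X₂.X i ⟶ (shift H).X i,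
      S.f.f i ≫ ψ = φ'.f i ≫ contractible.fst _ i :=
    exists_extension_of_ext_one (hS.map_of_exact (HomologicalComplex.eval A _ i)) (h₃ i) _
  choose ψ hψ using hψ
  have hφψ : S.f ≫ contractible.lift ψ = φ' := contractible.hom_ext_fst fun i => by
    rw [HomologicalComplex.comp_f, Category.assoc, contractible.lift_fst, hψ]
  exact ⟨contractible.lift ψ ≫ (shiftShortComplex _ (shiftXIso_hom_comp_d H)).g, by
    rw [reassoc_of% hφψ, hφ']⟩

end DegreewiseExt

section Evaluation

variable {A : Type u} [Category.{v} A] [Abelian A]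

/-- The complex of the terms of degree `j` of a complex of complexes. -/
noncomputable abbrev evalComplex (T : ChainComplex (ChainComplex A ℤ) ℤ) (j : ℤ) :
    ChainComplex A ℤ :=
  ((HomologicalComplex.eval A (ComplexShape.down ℤ) j).mapHomologicalComplex _).obj T

lemma exists_hom_f_eq {K : ChainComplex A ℤ} {B : A} {j : ℤ} (φ : K.X j ⟶ B) :
    ∃ f : K ⟶ contractible fun _ => B, f.f j ≫ contractible.fst _ j = φ ∧
      ∀ i, i ≠ j → f.f i ≫ contractible.fst _ i = 0 := by
  classical
  exact ⟨contractible.lift (M := fun _ => B) fun i =>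
    if h : i = j then (K.XIsoOfEq h).hom ≫ φ else 0, by simp, fun i hi => by simp [hi]⟩

lemma homExact_evalComplex {T : ChainComplex (ChainComplex A ℤ) ℤ} {B : A}
    (hT : HomExact T (contractible fun _ => B)) (j : ℤ) : HomExact (evalComplex T j) B := by
  refine fun n => fun (φ : (T.X n).X j ⟶ B) => ⟨fun hφ => ?_, ?_⟩
  · replace hφ : (T.d (n + 1) n).f j ≫ φ = 0 := hφ
    obtain ⟨f, hf, hf'⟩ := exists_hom_f_eq φ
    obtain ⟨g, rfl⟩ := (hT n f).1 <| contractible.hom_ext_fst fun i => by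
      obtain rfl | hi := eq_or_ne i j
      · simp [hf, hφ]
      · simp [hf' i hi]
    rw [HomologicalComplex.comp_f, Category.assoc] at hf
    exact ⟨g.f j ≫ contractible.fst _ j, hf⟩
  · rintro ⟨ψ, rfl⟩
    exact (evalComplex T j).d_comp_d_assoc _ _ _ ψ |>.trans zero_comp

lemma HasCompleteResolution.eval {P Q F : ObjectProperty (ChainComplex A ℤ)}
    {P' Q' F' : ObjectProperty A} {j : ℤ} (hP : ∀ K, P K → P' (K.X j))
    (hQ : ∀ K, Q K → Q' (K.X j)) (hF : ∀ B, F' B → F (contractible fun _ => B))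
    {K : ChainComplex A ℤ} (hK : HasCompleteResolution P Q F K) :
    HasCompleteResolution P' Q' F' (K.X j) := by
  obtain ⟨T, hT, hTF, hTP, hTQ, ⟨e⟩⟩ := hK
  let E := HomologicalComplex.eval A (ComplexShape.down ℤ) j
  exact ⟨evalComplex T j, fun n => (hT n).map E,
    fun B hB => homExact_evalComplex (hTF _ (hF B hB)) j,
    fun i hi => hP _ (hTP i hi), fun i hi => hQ _ (hTQ i hi),
    ⟨E.mapIso e ≪≫ (PreservesImage.iso E (T.d 0 (-1))).symm⟩⟩

end Evaluation

section EnoughProjectives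

lemma IsEnoughProjectives.enoughProjectives {A : Type u} [Category.{v} A] {P : ObjectProperty A}
    (hP : IsEnoughProjectives P) : EnoughProjectives A where
  presentation X := by
    obtain ⟨Y, p, hY, _⟩ := hP.exists_epi X
    have := hP.projective hY
    exact ⟨⟨Y, p⟩⟩

lemma IsEnoughProjectives.tildeClass {A : Type u} [Category.{v} A] [Abelian A]
    [HasExt.{w} A] {P : ObjectProperty A} [P.IsClosedUnderIsomorphisms]
    (hP : IsEnoughProjectives P) : IsEnoughProjectives (tildeClass P) where
  projective K hK := by
    have := fun i => hP.projective (hK.2 i)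
    have := contractible.projective this
    obtain ⟨r⟩ := hK.nonempty_retract fun _ Y hX _ => hP.extOrthogonal hX Y
    exact r.projective
  exists_epi K := by
    choose Y p hY hp using hP.exists_epi
    refine ⟨contractible fun i => Y (K.X (i + 1)),
      contractible.desc fun i j hij => p _ ≫ (K.XIsoOfEq hij).hom,
      contractible.mem_tildeClass fun i => hY _, ?_⟩
    have (i : ℤ) : Epi ((contractible.desc (M := fun i => Y (K.X (i + 1)))
      fun i j hij => p _ ≫ (K.XIsoOfEq hij).hom).f i) :=
      epi_of_epi_fac (contractible.inr_desc _ i)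
    exact HomologicalComplex.epi_of_epi_f _ this

end EnoughProjectives

section Resolution

variable {A : Type u} [Category.{v} A] [Abelian A] [HasExt.{w} A] {N B : A}

/-- The object resolved by `P` is the cokernel of the last differential of `P`. -/
noncomputable def opcyclesZeroIso (P : ProjectiveResolution N) : P.complex.opcycles 0 ≅ N :=
  IsColimit.coconePointUniqueUpToIso (P.complex.opcyclesIsCokernel 1 0 (by simp))
    P.isColimitCokernelCofork

lemma extOrthogonal_iff_exact (P : ProjectiveResolution N) : ExtOrthogonal N B ↔
    ∀ k, Function.Exact (fun ψ : P.complex.X k ⟶ B => P.complex.d (k + 1) k ≫ ψ)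
      (fun ψ : P.complex.X (k + 1) ⟶ B => P.complex.d (k + 2) (k + 1) ≫ ψ) := by
  have hS (k : ℕ) := shortExact_opcyclesShortComplex P.complex (j := k + 1) (i := k) (by simp)
    (P.complex_exactAt_succ k)
  have hex (k : ℕ) := exact_comp_d_iff P.complex (k := k + 2) (j := k + 1) (i := k) (by simp) B
  refine ⟨fun h k => (hex k).2 ?_, fun h => ?_⟩
  · have hk : ExtOrthogonal (P.complex.opcycles k) B := by
      induction k with
      | zero => exact h.of_iso (opcyclesZeroIso P)
      | succ k ih => exact .X₁ (hS k) (.of_projective _ _) ih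
    exact hk.exists_extension (hS k)
  · exact .of_iso (opcyclesZeroIso P).symm <| .of_family hS (fun k => ⟨k + 1, ⟨Iso.refl _⟩⟩)
      (fun k => .of_projective _ _) (fun k => (hex k).1 (h k)) 0

end Resolution

section Modules

open TensorProduct

variable {R : Type u} [CommRing R]

lemma exists_extension_of_surjective_lcomp {M N B P : Type*} [AddCommGroup M] [Module R M]
    [AddCommGroup N] [Module R N] [AddCommGroup B] [Module R B] [AddCommGroup P] [Module R P]
    [Module.Projective R P] {f : M →ₗ[R] N} (hf : Function.Surjective (LinearMap.lcomp R B f))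
    (φ : M ⊗[R] P →ₗ[R] B) : ∃ ψ : N ⊗[R] P →ₗ[R] B, ψ ∘ₗ f.rTensor P = φ := by
  obtain ⟨s, hs⟩ := Module.projective_lifting_property _ (TensorProduct.curry φ).flip hf
  refine ⟨TensorProduct.lift s.flip, TensorProduct.ext' fun m p => ?_⟩
  simpa using LinearMap.congr_fun (LinearMap.congr_fun hs p) m

/-- As `Mᵢ` is finite projective, `Hom(Mᵢ, B ⊗ F) ≃ Hom(Mᵢ, B) ⊗ F`. -/
lemma exact_lcomp_tensor {M₁ M₂ M₃ B : Type*} (F : Type*) [AddCommGroup M₁] [Module R M₁]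
    [AddCommGroup M₂] [Module R M₂] [AddCommGroup M₃] [Module R M₃] [AddCommGroup B] [Module R B]
    [AddCommGroup F] [Module R F] [Module.Flat R F]
    [Module.Finite R M₁] [Module.Projective R M₁] [Module.Finite R M₂] [Module.Projective R M₂]
    [Module.Finite R M₃] [Module.Projective R M₃] {f : M₁ →ₗ[R] M₂} {g : M₂ →ₗ[R] M₃}
    (h : Function.Exact (LinearMap.lcomp R B g) (LinearMap.lcomp R B f)) :
    Function.Exact (LinearMap.lcomp R (B ⊗[R] F) g) (LinearMap.lcomp R (B ⊗[R] F) f) := by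
  refine (Function.Exact.iff_of_ladder_linearEquiv
    (e₁ := rTensorHomEquivHomRTensor R M₃ B F) (e₂ := rTensorHomEquivHomRTensor R M₂ B F)
    (e₃ := rTensorHomEquivHomRTensor R M₁ B F) ?_ ?_).2 (Module.Flat.rTensor_exact F h) <;>
  · ext
    simp

lemma exact_comp_iff_exact_lcomp {M₁ M₂ M₃ : ModuleCat.{u} R} (f : M₁ ⟶ M₂) (g : M₂ ⟶ M₃)
    (B : ModuleCat.{u} R) :
    Function.Exact (fun ψ : M₃ ⟶ B => g ≫ ψ) (fun ψ : M₂ ⟶ B => f ≫ ψ) ↔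
      Function.Exact (LinearMap.lcomp R B g.hom) (LinearMap.lcomp R B f.hom) :=
  (Function.Exact.iff_of_ladder_addEquiv (f₁₂ := Preadditive.leftComp B g)
    (f₂₃ := Preadditive.leftComp B f) (g₁₂ := (LinearMap.lcomp R B g.hom).toAddMonoidHom)
    (g₂₃ := (LinearMap.lcomp R B f.hom).toAddMonoidHom)
    ModuleCat.homAddEquiv ModuleCat.homAddEquiv ModuleCat.homAddEquiv rfl rfl).symm

namespace ExtOrthogonal

variable {N B : ModuleCat.{u} R}

lemma tensor_flat (h : ExtOrthogonal N B) (P : ProjectiveResolution N)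
    (hP : ∀ n, Module.Finite R (P.complex.X n)) (F : Type u) [AddCommGroup F] [Module R F]
    [Module.Flat R F] : ExtOrthogonal N (ModuleCat.of R (B ⊗[R] F)) := by
  have hP' (n : ℕ) : Module.Projective R (P.complex.X n) :=
    ModuleCat.projective_of_module_projective _
  rw [extOrthogonal_iff_exact P] at h ⊢
  exact fun k => (exact_comp_iff_exact_lcomp _ _ _).2 <|
    exact_lcomp_tensor F <| (exact_comp_iff_exact_lcomp _ _ _).1 (h k)

/-- `P` being projective, the syzygies of `N ⊗ P` are `K ⊗ P` for `K` a syzygy of `N`. -/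
lemma tensor_projective (h : ExtOrthogonal N B) (P : Type u) [AddCommGroup P] [Module R P]
    [Module.Projective R P] : ExtOrthogonal (ModuleCat.of R (N ⊗[R] P)) B := by
  have hS (N : ModuleCat.{u} R) := shortExact_syzygyShortComplex N
  let G := MonoidalCategory.tensorRight (ModuleCat.of R P)
  refine of_family (ι := {N : ModuleCat.{u} R // ExtOrthogonal N B})
    (S := fun N => (syzygyShortComplex N.1).map G) (fun N => (hS N.1).map_of_exact G)
    (fun N => ?_) (fun N => ?_) (fun N φ => ?_) ⟨N, h⟩
  · exact ⟨⟨_, X₁ (hS N.1) (of_projective _ _) N.2⟩, ⟨Iso.refl _⟩⟩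
  · have : Projective (ModuleCat.of R ((Projective.over N.1 : ModuleCat R) ⊗[R] P)) :=
      ModuleCat.projective_of_categoryTheory_projective _
    exact of_projective (ModuleCat.of R ((Projective.over N.1 : ModuleCat R) ⊗[R] P)) B
  · have hsurj : Function.Surjective (LinearMap.lcomp R B (kernel.ι (Projective.π N.1)).hom) :=
      fun t => by
        obtain ⟨s, hs⟩ := exists_extension (hS N.1) N.2 (ModuleCat.ofHom t)
        exact ⟨s.hom, ModuleCat.hom_ext_iff.1 hs⟩
    obtain ⟨ψ, hψ⟩ := exists_extension_of_surjective_lcomp hsurj φ.hom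
    exact ⟨ModuleCat.ofHom ψ, ModuleCat.hom_ext hψ⟩

end ExtOrthogonal

end Modules

section Modules

open TensorProduct

variable {R : Type u} [CommRing R]

instance : (projectiveModules R).IsClosedUnderIsomorphisms where
  of_iso {_ _} e (_ : Module.Projective R _) := Module.Projective.of_equiv e.toLinearEquiv

lemma isEnoughProjectives_projectiveModules : IsEnoughProjectives (projectiveModules R) where
  projective X hX :=
    have : Module.Projective R X := hX
    ModuleCat.projective_of_categoryTheory_projective X
  exists_epi X := ⟨Projective.over X, Projective.π X,
    ModuleCat.projective_of_module_projective (Projective.over X), inferInstance⟩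

instance : (projectiveModules R).IsClosedUnderBinaryProducts :=
  isClosedUnderBinaryProducts_of_biprod _ fun X Y hX hY =>
    have : Projective X := isEnoughProjectives_projectiveModules.projective hX
    have : Projective Y := isEnoughProjectives_projectiveModules.projective hY
    ModuleCat.projective_of_module_projective (X ⊞ Y)

variable (C : ModuleCat.{u} R)

instance : (cProjectiveModules C).IsClosedUnderIsomorphisms where
  of_iso := by
    rintro X Y e ⟨P, hP, ⟨f⟩⟩
    exact ⟨P, hP, ⟨e.symm.toLinearEquiv ≪≫ₗ f⟩⟩

instance : (cFlatModules C).IsClosedUnderIsomorphisms where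
  of_iso := by
    rintro X Y e ⟨P, hP, ⟨f⟩⟩
    exact ⟨P, hP, ⟨e.symm.toLinearEquiv ≪≫ₗ f⟩⟩

lemma cProjectiveModules_le_cFlatModules : cProjectiveModules C ≤ cFlatModules C :=
  fun _ ⟨P, _, e⟩ => ⟨P, inferInstance, e⟩

instance : (cProjectiveModules C).ContainsZero where
  exists_zero := ⟨ModuleCat.of R (C ⊗[R] PUnit.{u + 1}), ModuleCat.isZero_of_subsingleton _,
    ModuleCat.of R PUnit, inferInstanceAs (Module.Projective R PUnit.{u + 1}), ⟨.refl _ _⟩⟩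

instance : (cProjectiveModules C).IsClosedUnderBinaryProducts := by
  refine isClosedUnderBinaryProducts_of_biprod _ fun X Y ⟨P, _, ⟨e⟩⟩ ⟨P', _, ⟨e'⟩⟩ => ?_
  exact ⟨ModuleCat.of R (P × P'), inferInstanceAs (Module.Projective R (P × P')),
    ⟨(ModuleCat.biprodIsoProd X Y).toLinearEquiv ≪≫ₗ e.prodCongr e' ≪≫ₗ
      (TensorProduct.prodRight R R C P P').symm⟩⟩

variable {C}

lemma IsSemidualizing.extOrthogonal (hC : IsSemidualizing C) (X B : ModuleCat.{u} R)
    (hX : cProjectiveModules C X) (hB : cFlatModules C B) : ExtOrthogonal X B := by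
  obtain ⟨P, _, ⟨e⟩⟩ := hX
  obtain ⟨F, _, ⟨f⟩⟩ := hB
  obtain ⟨T, hT⟩ := hC.exists_resolution
  have hCC : ExtOrthogonal C C := fun n => hC.ext_eq_zero (n + 1) (by lia)
  exact (((hCC.tensor_flat T hT F).tensor_projective P).of_iso e.toModuleIso).of_iso_right
    f.toModuleIso

end Modules

end DingC

open DingC in
theorem corollary2p12_general {A : Type u} [Category.{v} A] [Abelian A] [HasExt.{w} A]
    [HasExt.{w} (ChainComplex A ℤ)] {P Q F : ObjectProperty A}
    [P.IsClosedUnderIsomorphisms] [P.IsClosedUnderBinaryProducts]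
    [Q.IsClosedUnderIsomorphisms] [Q.IsClosedUnderBinaryProducts] [Q.ContainsZero]
    [F.IsClosedUnderIsomorphisms] (hP : IsEnoughProjectives P) (hQF : Q ≤ F)
    (hQ : ∀ X B, Q X → F B → ExtOrthogonal X B)
    {S : ShortComplex (ChainComplex A ℤ)} (hS : S.ShortExact)
    (h₁ : HasCompleteResolution (tildeClass P) (tildeClass Q) (tildeClass F) S.X₁)
    (h₂ : HasCompleteResolution (tildeClass P) (tildeClass Q) (tildeClass F) S.X₂) :
    List.TFAE [
      HasCompleteResolution (tildeClass P) (tildeClass Q) (tildeClass F) S.X₃,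
      ∀ i, HasCompleteResolution P Q F (S.X₃.X i),
      ∀ H, tildeClass F H → Subsingleton (Abelian.Ext S.X₃ H 1)] := by
  have := hP.enoughProjectives
  have hQQ (X Y : A) (hX : Q X) (hY : Q Y) : ExtOrthogonal X Y := hQ X Y hX (hQF _ hY)
  have hQ' (K H) (hK : tildeClass Q K) (hH : tildeClass F H) : ExtOrthogonal K H :=
    hK.extOrthogonal hQQ hQ hH
  replace h₁ := h₁.hasOrthogonalCoresolution hP.tildeClass hQ'
  replace h₂ := h₂.hasOrthogonalCoresolution hP.tildeClass hQ'
  tfae_have 1 → 2 := fun h i => h.eval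
    (fun _ hK => hK.X (fun _ Y hX _ => hP.extOrthogonal hX Y) i) (fun _ hK => hK.X hQQ i)
    fun _ hB => contractible.mem_tildeClass fun _ => hB
  tfae_have 2 → 3 := fun h H hH => ext_one_of_degreewise hS (h₁.extOrthogonal hH.shift 0)
    (h₂.extOrthogonal hH 0) fun i => hH.shift.extOrthogonal_X
      (fun _ => ((h i).hasOrthogonalCoresolution hP hQ).extOrthogonal) i 0
  tfae_have 3 → 1 := fun h => (HasOrthogonalCoresolution.X₃ hS h₁ h₂ h
    (fun _ hK => ⟨hK.1, fun i => hQF _ (hK.2 i)⟩) hQ').hasCompleteResolution hP.tildeClass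
  tfae_finish

theorem corollary2p12 {R : Type u} [CommRing R] (C : ModuleCat.{u} R)
    (hC : DingC.IsSemidualizing C)
    (S : ShortComplex (ChainComplex (ModuleCat.{u} R) ℤ)) (hS : S.ShortExact)
    (hX : DingC.IsDCProjectiveComplex C S.X₁) (hY : DingC.IsDCProjectiveComplex C S.X₂) :
    List.TFAE [
      DingC.IsDCProjectiveComplex C S.X₃,
      ∀ i : ℤ, DingC.IsDCProjectiveModule C (S.X₃.X i),
      ∀ H : ChainComplex (ModuleCat.{u} R) ℤ, DingC.cFlatComplexes C H →
        Subsingleton (Abelian.Ext.{u} S.X₃ H 1)] :=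
  corollary2p12_general DingC.isEnoughProjectives_projectiveModules
    (DingC.cProjectiveModules_le_cFlatModules C) hC.extOrthogonal hS hX hY
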